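/- Let $\sigma_1,\sigma_2,\sigma_3$ be the Pauli matrices and let $\rho$ be a two-qubit state on $\mathcal H_A\otimes\mathcal H_B$. Write $\rho^{A\to B}(A)=\operatorname{Tr}_A[\rho(A\otimes\mathbb I)]$ and $X'=\rho^{A\to B}(X)$, let $\mathcal P_A$ be the set of hermitian operators of unit trace on $\mathcal H_A$ and $\mathcal S_A=\{A\in\mathcal P_A : 0\le A\le \mathbb I\}$. The state $\rho$ is called *unsteerable* (from Alice's side, with respect to projective measurements) if there is an ensemble of positive operators $(B_\lambda)_{\lambda\in\Lambda}$ on $\mathcal H_B$, indexed by a probability space $(\Lambda,\nu)$ and with integrable entries, such that $\int B_\lambda\,d\nu=\mathbb I'$ and such that for every projective measurement $\{P_1,P_2\}$ on $A$ there are measurable $G_1,G_2:\Lambda\to[0,1]$ with $G_1+G_2=1$ and $P_i'=\int G_i(\lambda)B_\lambda\,d\nu$ for $i=1,2$. For a unit vector $n\in S^2\subset\mathbb R^3$ put $\Pi_n=\frac12(\mathbb I+\sum_i n_i\sigma_i)$. An *ansatz* for $\rho$ is a Borel probability measure $\mu$ on $S^2$ with $\int\Pi_n\,d\mu(n)=\mathbb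 I'$; its *box* is $\{\int g(n)\Pi_n\,d\mu(n) : g:S^2\to[0,1]\text{ measurable}\}$. When $\rho^{A\to B}$ is injective, the *principal radius* $r_\mu$ is the least distance from $\frac12\mathbb I'$ to the boundary, relative to $\mathcal P_A'$, of $\operatorname{box}(\mu)\cap\mathcal P_A'$, where distances within $\mathcal P_A'$ are measured by the metric for which $\mathcal S_A'$ is the unit ball centred at $\frac12\mathbb I'$. The *critical radius* is $R=\sup_\mu r_\mu$, over all ansätze $\mu$ for $\rho$. **Theorem.** Let $T$ be a real diagonal $3\times3$ matrix with $\det T\neq0$ such that $$\rho=\tfrac{\mathbb I}{2}\otimes\tfrac{\mathbb I}{2}+\tfrac14\sum_{i,j=1}^3T_{ij}\,\sigma_i\otimes\sigma_j$$ is a state (a non-degenerate T-state). Let $dS$ be the area measure on $S^2$, let $N_T=\left(\int_{S^2}(n^{\mathsf T}T^{-2}n)^{-2}\,dS(n)\right)^{-1}$, and let $J$ be the measure on $S^2$ with density $N_T\,(n^{\mathsf T}T^{-2}n)^{-2}$ with respect to $dS$. Then $J$ is an ansatz for $\rho$, it maximizes the principal radius among all ansätze for $\rho$, and $$R=r_J=2\pi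 N_T\,|\det T|.$$ Moreover $\rho$ is unsteerable if and only if $2\pi N_T\,|\det T|\ge1$. -/

import Mathlib

open MeasureTheory
open scoped Kronecker Matrix ComplexOrder

noncomputable section

namespace TwoQubit

/-- Operators on a qubit, in a fixed orthonormal basis. -/
abbrev Op : Type := Matrix (Fin 2) (Fin 2) ℂ

/-- Operators on the two-qubit system `AB`; the first index belongs to `A`, the second to `B`. -/
abbrev Op₂ : Type := Matrix (Fin 2 × Fin 2) (Fin 2 × Fin 2) ℂ

/-- A state of two qubits: a positive semi-definite operator of unit trace. -/
structure IsState (ρ : Op₂) : Prop where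
  posSemidef : ρ.PosSemidef
  trace_eq_one : ρ.trace = 1

/-- The partial trace over `A`. -/
def partialTraceA (M : Op₂) : Op := Matrix.of fun k l => ∑ i : Fin 2, M (i, k) (i, l)

/-- Alice's EPR map `A ↦ Tr_A [ρ (A ⊗ 1)]`. -/
def eprMap (ρ : Op₂) (A : Op) : Op := partialTraceA (ρ * (A ⊗ₖ (1 : Op)))

/-! ### Measurement outcomes, Bloch hyperplane and Bloch ball of Alice -/

/-- Alice's measurement outcomes `O ≤ M ≤ 1`. -/
def outcomes : Set Op := {M | M.PosSemidef ∧ (1 - M).PosSemidef}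

/-- The Bloch hyperplane: hermitian operators of unit trace. -/
def blochHyperplane : Set Op := {A | A.IsHermitian ∧ A.trace = 1}

/-- The Bloch ball. -/
def blochBall : Set Op := blochHyperplane ∩ outcomes

/-! ### Integration of operator-valued functions -/

/-- All matrix entries of an operator-valued function are integrable. -/
def OpIntegrable {Λ : Type} [MeasurableSpace Λ] (B : Λ → Op) (ν : Measure Λ) : Prop :=
  ∀ k l, Integrable (fun x => B x k l) ν

/-- The integral of an operator-valued function, entry by entry. -/
def opIntegral {Λ : Type} [MeasurableSpace Λ] (ν : Measure Λ) (B : Λ → Op) : Op :=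
  Matrix.of fun k l => ∫ x, B x k l ∂ν

/-! ### Steerability with respect to projective measurements -/

/-- A two-outcome projective measurement: a decomposition of the identity into two orthogonal
projections. -/
def IsProjectiveMeasurement (P : Fin 2 → Op) : Prop :=
  (∀ i, IsStarProjection (P i)) ∧ P 0 + P 1 = 1

/-- `ρ` is unsteerable from Alice's side with respect to projective measurements: there is an
ensemble `B` of positive operators (local hidden states), indexed by a probability space, which
decomposes Bob's reduced state and from which each conditional ensemble of Bob is obtained by a
stochastic map `G`. A finite ensemble is the case of a finite index space. -/
def Unsteerable (ρ : Op₂) : Prop :=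
  ∃ (Λ : Type) (_ : MeasurableSpace Λ) (ν : Measure Λ) (B : Λ → Op),
    IsProbabilityMeasure ν ∧ (∀ x, (B x).PosSemidef) ∧ OpIntegrable B ν ∧
    opIntegral ν B = eprMap ρ 1 ∧
    ∀ P : Fin 2 → Op, IsProjectiveMeasurement P →
      ∃ G : Fin 2 → Λ → ℝ,
        (∀ i, Measurable (G i)) ∧ (∀ i x, 0 ≤ G i x ∧ G i x ≤ 1) ∧
        (∀ x, G 0 x + G 1 x = 1) ∧
        ∀ i, eprMap ρ (P i) = opIntegral ν (fun x => G i x • B x)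

/-! ### Ansatz, box, principal radius, critical radius -/

/-- The three Pauli matrices. -/
def pauli : Fin 3 → Op :=
  ![!![0, 1; 1, 0], !![0, -Complex.I; Complex.I, 0], !![1, 0; 0, -1]]

/-- The unit sphere of `ℝ³` (the Bloch sphere). -/
abbrev BlochSphere : Type := Metric.sphere (0 : EuclideanSpace ℝ (Fin 3)) 1

/-- The pure state `(1 + n · σ) / 2` with Bloch vector `n`. -/
def pureState (n : BlochSphere) : Op :=
  (1 / 2 : ℂ) • (1 + ∑ i : Fin 3, (n.1 i : ℂ) • pauli i)

/-- An ansatz for `ρ`: a probability distribution on Bob's Bloch sphere whose principal vertex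
is Bob's reduced state. -/
def IsAnsatz (ρ : Op₂) (μ : Measure BlochSphere) : Prop :=
  IsProbabilityMeasure μ ∧ opIntegral μ pureState = eprMap ρ 1

/-- The box based on the ensemble of pure states distributed according to `μ`. -/
def box (μ : Measure BlochSphere) : Set Op :=
  {M | ∃ g : BlochSphere → ℝ, Measurable g ∧ (∀ n, 0 ≤ g n ∧ g n ≤ 1) ∧
    M = opIntegral μ (fun n => g n • pureState n)}

/-- The image of the Bloch hyperplane under Alice's EPR map. -/
def steeringHyperplane (ρ : Op₂) : Set Op := eprMap ρ '' blochHyperplane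

/-- The image of the Bloch ball under Alice's EPR map. -/
def steeringBall (ρ : Op₂) : Set Op := eprMap ρ '' blochBall

/-- The centre of the steering ball, half of Bob's reduced state. -/
def steeringCentre (ρ : Op₂) : Op := (1 / 2 : ℝ) • eprMap ρ 1

/-- The distance within the steering hyperplane for which the steering ball is the unit ball
around its centre (for a non-degenerate EPR map): the gauge of the recentred steering ball. -/
def steeringDist (ρ : Op₂) (B C : Op) : ℝ :=
  gauge ((fun X => X - steeringCentre ρ) '' steeringBall ρ) (B - C)

/-- The boundary of `K ∩ P` relative to `P`. -/
def relBoundary (P K : Set Op) : Set Op :=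
  (Subtype.val : P → Op) '' frontier ((Subtype.val : P → Op) ⁻¹' K)

/-- The principal radius of the ansatz `μ`: the least distance from the centre of the steering
ball to the boundary of the section of the box by the steering hyperplane. -/
def principalRadius (ρ : Op₂) (μ : Measure BlochSphere) : ℝ :=
  sInf ((fun B => steeringDist ρ B (steeringCentre ρ)) ''
    relBoundary (steeringHyperplane ρ) (box μ))

/-- Alice's critical radius of local models. -/
def criticalRadius (ρ : Op₂) : ℝ :=
  sSup {r | ∃ μ : Measure BlochSphere, IsAnsatz ρ μ ∧ r = principalRadius ρ μ}

/-! ### T-states and the distribution of Jevtic et al. -/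

/-- The operator `(1/2) ⊗ (1/2) + (1/4) ∑ T i j σ_i ⊗ σ_j`. -/
def tState (T : Matrix (Fin 3) (Fin 3) ℝ) : Op₂ :=
  ((1 / 2 : ℂ) • (1 : Op)) ⊗ₖ ((1 / 2 : ℂ) • (1 : Op)) +
    (1 / 4 : ℂ) • ∑ i : Fin 3, ∑ j : Fin 3, (T i j : ℂ) • (pauli i ⊗ₖ pauli j)

/-- The area measure on the Bloch sphere. -/
def areaMeasure : Measure BlochSphere :=
  (volume : Measure (EuclideanSpace ℝ (Fin 3))).toSphere

/-- The function `(nᵀ T⁻² n)⁻²` on the Bloch sphere. -/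
def jevticWeight (T : Matrix (Fin 3) (Fin 3) ℝ) (n : BlochSphere) : ℝ :=
  ((n.1.ofLp ⬝ᵥ ((T⁻¹ ^ 2) *ᵥ n.1.ofLp)) ^ 2)⁻¹

/-- The normalization factor `N_T`. -/
def jevticNorm (T : Matrix (Fin 3) (Fin 3) ℝ) : ℝ :=
  (∫ n, jevticWeight T n ∂areaMeasure)⁻¹

/-- The distribution with area density `J(n) = N_T (nᵀ T⁻² n)⁻²`. -/
def jevticAnsatz (T : Matrix (Fin 3) (Fin 3) ℝ) : Measure BlochSphere :=
  areaMeasure.withDensity fun n => ENNReal.ofReal (jevticNorm T * jevticWeight T n)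

end TwoQubit

end

noncomputable section

/-! In Bloch coordinates the EPR map is `(t, v) ↦ (t/2, Dv/2)`, with `D` the symmetric map given by
`T`. The steering hyperplane is parametrized by `a ↦ (1/2, Da/2)`, and the steering distance of such
a point from the centre is `‖a‖`.

Upper bound: let `b` be a vector ensemble with mean `0` and `∫ ‖b‖ ≤ 1`. If response functions reach
`D(s e)/2` for every unit `e`, take `e = Du/‖Du‖` and pair with the unit vector `u`; this gives
`s‖Du‖ ≤ ∫ |⟨b, u⟩|`. Averaging over `u`, with `∫ |⟨n, u⟩| dS(n) = 2π‖u‖`, yields `s ∫ ‖Du‖ dS ≤ 2π`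
(`mul_integral_norm_le_two_pi`). This bounds the principal radius of every ansatz and, with `s = 1`,
obstructs every local hidden state model.

Attainment: the weight of `J` is `‖D⁻¹n‖⁻⁴`, and for `g` positively homogeneous of degree one the
substitution `n ↦ D⁻¹n` gives `∫ ‖D⁻¹n‖⁻⁴ g(D⁻¹n) dS = |det D| ∫ g dS`
(`integral_weight_smul_comp_symm`). With `g = ‖D·‖` this shows `2π N_T |det T| = 2π / ∫ ‖Du‖ dS`,
the upper bound above. With `g(x) = sign⟨x, e⟩ Dx` it shows that responses `1/2 + (t/2) sign⟨D⁻¹n,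
e⟩` fill the whole ellipsoid of that radius (`steeringPoint_mem_box_jevticAnsatz`). -/

theorem inter_frontier_nonempty_of_isPreconnected {X : Type*} [TopologicalSpace X] {s t : Set X}
    (hs : IsPreconnected s) (h : (s ∩ t).Nonempty) (h' : (s ∩ tᶜ).Nonempty) :
    (s ∩ frontier t).Nonempty := by
  by_contra hne
  have hdisj : ∀ x ∈ s, x ∉ frontier t := fun x hx hf => hne ⟨x, hx, hf⟩
  have hint : ∀ x ∈ s, x ∈ closure t → x ∈ interior t := fun x hx hc => by
    by_contra hi
    exact hdisj x hx ⟨hc, hi⟩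
  obtain ⟨x, hx, hxt⟩ := h
  obtain ⟨y, hy, hyt⟩ := h'
  -- If `s` avoided the frontier, these two disjoint open sets would cover `s` and both meet it.
  obtain ⟨z, -, hz1, hz2⟩ := hs (interior t) (closure t)ᶜ isOpen_interior
    isClosed_closure.isOpen_compl
    (fun z hz => (em (z ∈ closure t)).imp (hint z hz) id)
    ⟨x, hx, hint x hx (subset_closure hxt)⟩
    ⟨y, hy, fun hc => hyt (interior_subset (hint y hy hc))⟩
  exact hz2 (subset_closure (interior_subset hz1))

/-! ### Polar coordinates and transformation of sphere integrals -/

section SphereIntegral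

open Metric Set Module

variable {E F : Type*} [NormedAddCommGroup E] [NormedSpace ℝ E] [MeasurableSpace E]
  [BorelSpace E] [FiniteDimensional ℝ E] [Nontrivial E] (μ : Measure E) [μ.IsAddHaarMeasure]
  [NormedAddCommGroup F] [NormedSpace ℝ F]

theorem integral_eq_integral_sphere_prod (H : E → F) :
    ∫ x, H x ∂μ = ∫ p : sphere (0 : E) 1 × Ioi (0 : ℝ), H (p.2.1 • p.1.1)
      ∂μ.toSphere.prod (.volumeIoiPow (finrank ℝ E - 1)) := by
  rw [← μ.measurePreserving_homeomorphUnitSphereProd.integral_comp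
    (Homeomorph.measurableEmbedding _), ← setIntegral_univ,
    ← setIntegral_congr_set (s := {0}ᶜ) (by simp [ae_eq_univ]),
    ← integral_subtype_comap (measurableSet_singleton _).compl]
  refine integral_congr_ae (.of_forall fun x => ?_)
  have hx : (x : E) ≠ 0 := x.2
  simp [smul_smul, hx]

omit [Nontrivial E] [NormedSpace ℝ F] in
theorem integrable_sphere_prod {H : E → F} (hH : Integrable H μ) :
    Integrable (fun p : sphere (0 : E) 1 × Ioi (0 : ℝ) => H (p.2.1 • p.1.1))
      (μ.toSphere.prod (.volumeIoiPow (finrank ℝ E - 1))) := by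
  rw [← μ.measurePreserving_homeomorphUnitSphereProd.integrable_comp_emb
    (Homeomorph.measurableEmbedding _)]
  have : IntegrableOn H {0}ᶜ μ := hH.integrableOn
  rw [integrableOn_iff_comap_subtypeVal (measurableSet_singleton _).compl] at this
  refine this.congr (.of_forall fun x => ?_)
  have hx : (x : E) ≠ 0 := x.2
  simp [smul_smul, hx]

/-- With `d` the dimension, `y ↦ ‖y‖^d f(y)` has degree zero, so along the ray through `n` the
integrand is constant up to radius `1/‖Ln‖` and then vanishes. The radial integral `∫ r^(d-1) dr =
1/(d‖Ln‖^d)` cancels the factor `‖Ln‖^d`. -/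
theorem integral_indicator_ball_comp_linear [CompleteSpace F] (L : E ≃L[ℝ] E) {f : E → F}
    (hf : StronglyMeasurable f) {C : ℝ} (hC : ∀ x, ‖x‖ ^ finrank ℝ E * ‖f x‖ ≤ C)
    (hom : ∀ r : ℝ, 0 < r → ∀ x, f (r • x) = (r ^ finrank ℝ E)⁻¹ • f x) :
    ∫ x, (ball (0 : E) 1).indicator (fun y => ‖y‖ ^ finrank ℝ E • f y) (L x) ∂μ =
      (finrank ℝ E : ℝ)⁻¹ • ∫ n, f (L n.1) ∂μ.toSphere := by
  have hd : 0 < finrank ℝ E := finrank_pos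
  have hint : Integrable
      (fun x => (ball (0 : E) 1).indicator (fun y => ‖y‖ ^ finrank ℝ E • f y) (L x)) μ := by
    have : (fun x => (ball (0 : E) 1).indicator (fun y => ‖y‖ ^ finrank ℝ E • f y) (L x)) =
        (L ⁻¹' ball 0 1).indicator (fun y => ‖L y‖ ^ finrank ℝ E • f (L y)) := by
      ext x; simp [indicator]
    rw [this, integrable_indicator_iff (L.continuous.measurable measurableSet_ball)]
    refine Measure.integrableOn_of_bounded (M := C) ?_ ?_ ?_
    · have : Bornology.IsBounded (L ⁻¹' ball 0 1) := by
        rw [← L.image_symm_eq_preimage]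
        exact L.symm.lipschitz.isBounded_image isBounded_ball
      exact this.measure_lt_top.ne
    · refine StronglyMeasurable.aestronglyMeasurable ?_
      exact (by fun_prop : Continuous fun y => ‖L y‖ ^ finrank ℝ E).stronglyMeasurable.smul
        (hf.comp_measurable L.continuous.measurable)
    · refine .of_forall fun x => ?_
      simpa [norm_smul] using hC (L x)
  rw [integral_eq_integral_sphere_prod, integral_prod _ (integrable_sphere_prod μ hint),
    ← integral_smul]
  refine integral_congr_ae (.of_forall fun n => ?_)
  have hn : n.1 ≠ 0 := ne_of_mem_sphere n.2 one_ne_zero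
  have hLn : 0 < ‖L n.1‖ := by simpa using hn
  let ρ : Ioi (0 : ℝ) := ⟨‖L n.1‖⁻¹, inv_pos.2 hLn⟩
  have key : ∀ r : Ioi (0 : ℝ),
      (ball (0 : E) 1).indicator (fun y => ‖y‖ ^ finrank ℝ E • f y) (L (r.1 • n.1)) =
      (Iio ρ).indicator (fun _ => ‖L n.1‖ ^ finrank ℝ E • f (L n.1)) r := by
    intro r
    have hr : 0 < r.1 := r.2
    have hiff : L (r.1 • n.1) ∈ ball (0 : E) 1 ↔ r ∈ Iio ρ := by
      rw [mem_ball_zero_iff, mem_Iio, ← Subtype.coe_lt_coe, map_smul, norm_smul,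
        Real.norm_of_nonneg hr.le, ← lt_div_iff₀ hLn, one_div]
    by_cases h : r ∈ Iio ρ
    · rw [indicator_of_mem (hiff.2 h), indicator_of_mem h, map_smul, hom _ hr, norm_smul,
        Real.norm_of_nonneg hr.le, smul_smul, mul_pow]
      congr 1
      field_simp
    · rw [indicator_of_notMem (hiff.not.2 h), indicator_of_notMem h]
  simp only [key]
  rw [integral_indicator_const _ measurableSet_Iio, smul_smul, measureReal_def,
    Measure.volumeIoiPow_apply_Iio, ENNReal.toReal_ofReal (by positivity), Nat.sub_add_cancel hd]
  congr 1
  have : ((finrank ℝ E - 1 : ℕ) : ℝ) + 1 = finrank ℝ E := by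
    rw [Nat.cast_pred hd]; ring
  rw [this]
  simp only [ρ, inv_pow]
  field_simp

/-- Change of variables on the unit sphere under a linear map, for a function that is positively
homogeneous of degree minus the dimension. -/
theorem integral_sphere_comp_linear [CompleteSpace F] (L : E ≃L[ℝ] E) {f : E → F}
    (hf : StronglyMeasurable f) {C : ℝ} (hC : ∀ x, ‖x‖ ^ finrank ℝ E * ‖f x‖ ≤ C)
    (hom : ∀ r : ℝ, 0 < r → ∀ x, f (r • x) = (r ^ finrank ℝ E)⁻¹ • f x) :
    ∫ n, f (L n.1) ∂μ.toSphere =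
      |LinearMap.det (L : E →ₗ[ℝ] E)|⁻¹ • ∫ n, f n.1 ∂μ.toSphere := by
  have hd : (finrank ℝ E : ℝ) ≠ 0 := by exact_mod_cast finrank_pos.ne'
  have h1 := integral_indicator_ball_comp_linear μ L hf hC hom
  -- The cases `L` and identity turn both sphere integrals into solid ones, which differ by the
  -- linear substitution `L` and hence by `|det L|⁻¹`.
  have h2 := integral_indicator_ball_comp_linear μ (.refl ℝ E) hf hC hom
  simp only [ContinuousLinearEquiv.refl_apply] at h2
  have hdet : LinearMap.det (L : E →ₗ[ℝ] E) ≠ 0 := (LinearEquiv.isUnit_det' L.toLinearEquiv).ne_zero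
  have hmap := Measure.map_linearMap_addHaar_eq_smul_addHaar μ hdet
  have h3 := (L.toHomeomorph.measurableEmbedding).integral_map (μ := μ)
    ((ball (0 : E) 1).indicator (fun y => ‖y‖ ^ finrank ℝ E • f y))
  have hL : (⇑L.toHomeomorph : E → E) = ⇑(L : E →ₗ[ℝ] E) := rfl
  rw [hL, hmap, integral_smul_measure, h2] at h3
  have h4 : ∀ x, (L : E →ₗ[ℝ] E) x = L x := fun _ => rfl
  simp only [h4] at h3
  rw [h1, smul_comm] at h3
  have := smul_right_injective F (inv_ne_zero hd) h3
  rw [← this, ENNReal.toReal_ofReal (abs_nonneg _), abs_inv]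

theorem integral_volumeIoiPow (k : ℕ) (h : ℝ → F) :
    ∫ r : Ioi (0 : ℝ), h r ∂(.volumeIoiPow k) = ∫ r in Ioi (0 : ℝ), r ^ k • h r := by
  simp only [Measure.volumeIoiPow, ENNReal.ofReal]
  rw [integral_withDensity_eq_integral_smul,
    integral_subtype_comap measurableSet_Ioi fun a ↦ Real.toNNReal (a ^ k) • h a,
    setIntegral_congr_fun measurableSet_Ioi fun x hx ↦ ?_]
  · rw [NNReal.smul_def, Real.coe_toNNReal _ (pow_nonneg hx.out.le _)]
  · exact (measurable_subtype_coe.pow_const _).real_toNNReal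

theorem integral_norm_smul_direction (h : ℝ → ℝ) (f : E → F) :
    ∫ x, h ‖x‖ • f (‖x‖⁻¹ • x) ∂μ =
      (∫ r in Ioi (0 : ℝ), r ^ (finrank ℝ E - 1) * h r) • ∫ n, f n.1 ∂μ.toSphere := by
  have := integral_volumeIoiPow (finrank ℝ E - 1) h
  simp only [smul_eq_mul] at this
  rw [integral_eq_integral_sphere_prod, ← this, ← integral_prod_smul,
    ← integral_prod_swap (fun z : Ioi (0 : ℝ) × sphere (0 : E) 1 => h z.1 • f z.2.1)]
  refine integral_congr_ae (.of_forall fun p => ?_)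
  have hr : 0 < p.2.1 := p.2.2
  simp [norm_smul, abs_of_pos hr, smul_smul, hr.ne']

/-- Multiply `f` of the direction by a radial cutoff: the volume integral is invariant under `R`,
and the common radial factor is nonzero and cancels. No homogeneity of `f` is needed. -/
theorem integral_sphere_comp_isometry {E : Type*} [NormedAddCommGroup E] [InnerProductSpace ℝ E]
    [MeasurableSpace E] [BorelSpace E] [FiniteDimensional ℝ E] [Nontrivial E]
    (R : E ≃ₗᵢ[ℝ] E) (f : E → F) :
    ∫ n, f (R n.1) ∂(volume : Measure E).toSphere = ∫ n, f n.1 ∂(volume : Measure E).toSphere := by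
  let h : ℝ → ℝ := (Iio 1).indicator 1
  have hc : ∫ r in Ioi (0 : ℝ), r ^ (finrank ℝ E - 1) * h r ≠ 0 := by
    have : ∀ r, r ^ (finrank ℝ E - 1) * h r =
        (Iio 1).indicator (fun r : ℝ => r ^ (finrank ℝ E - 1)) r := by
      intro r; by_cases hr : r < 1 <;> simp [h, hr]
    simp only [this]
    rw [setIntegral_indicator measurableSet_Iio, Ioi_inter_Iio, ← integral_Ioc_eq_integral_Ioo,
      ← intervalIntegral.integral_of_le zero_le_one, integral_pow]
    simp
    positivity
  have h1 := integral_norm_smul_direction (volume : Measure E) h f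
  have h2 := integral_norm_smul_direction (volume : Measure E) h (fun x => f (R x))
  rw [← R.measurePreserving.integral_comp R.toHomeomorph.measurableEmbedding] at h1
  simp only [LinearIsometryEquiv.norm_map] at h1
  simp only [map_smul] at h2
  exact smul_right_injective F hc (h2.symm.trans h1)

end SphereIntegral

namespace TwoQubit

open Set

local notation "E3" => EuclideanSpace ℝ (Fin 3)

/-! ### Explicit integrals over the unit sphere of `ℝ³` -/

theorem integral_abs_coord_mul_gaussian :
    ∫ x : E3, |x 2| * Real.exp (-‖x‖ ^ 2) = Real.pi := by
  have hg : ∫ x : ℝ, Real.exp (-x ^ 2) = √Real.pi := by simpa using integral_gaussian 1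
  have ha : ∫ x : ℝ, |x| * Real.exp (-x ^ 2) = 1 := by
    have h := integral_comp_abs (f := fun x : ℝ => x * Real.exp (-x ^ 2))
    simp only [sq_abs] at h
    have h2 := integral_rpow_mul_exp_neg_rpow (p := 2) (q := 1) (by norm_num) (by norm_num)
    norm_num at h2
    rw [h, h2]; norm_num
  let f : Fin 3 → ℝ → ℝ := ![fun x => Real.exp (-x ^ 2), fun x => Real.exp (-x ^ 2),
    fun x => |x| * Real.exp (-x ^ 2)]
  have := integral_fintype_prod_volume_eq_prod f
  simp only [Fin.prod_univ_three, f, Matrix.cons_val, hg, ha] at this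
  rw [Real.mul_self_sqrt Real.pi_pos.le, mul_one] at this
  rw [← this, ← (PiLp.volume_preserving_toLp (Fin 3)).integral_comp
    (MeasurableEquiv.toLp 2 _).measurableEmbedding]
  refine integral_congr_ae (.of_forall fun x => ?_)
  simp only [EuclideanSpace.norm_sq_eq, Fin.sum_univ_three, Real.norm_eq_abs, sq_abs, neg_add,
    Real.exp_add]
  ring

/-- Polar coordinates split the Gaussian integral, equal to `π`, into the radial factor `∫ r³
exp(-r²) dr = 1/2` and the wanted integral. -/
theorem integral_abs_coord : ∫ n, |n.1 2| ∂areaMeasure = 2 * Real.pi := by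
  have h := integral_norm_smul_direction (volume : Measure E3)
    (fun r => r * Real.exp (-r ^ 2)) (fun x => |x 2|)
  have h1 : ∫ r in Ioi (0 : ℝ), r ^ (Module.finrank ℝ E3 - 1) * (r * Real.exp (-r ^ 2)) = 1 / 2 := by
    have h2 := integral_rpow_mul_exp_neg_rpow (p := 2) (q := 3) (by norm_num) (by norm_num)
    norm_num at h2
    rw [← h2]
    refine setIntegral_congr_fun measurableSet_Ioi fun x _ => ?_
    simp
    ring
  have h3 : ∫ x : E3, (‖x‖ * Real.exp (-‖x‖ ^ 2)) • |(‖x‖⁻¹ • x) 2| = Real.pi := by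
    rw [← integral_abs_coord_mul_gaussian]
    refine integral_congr_ae (.of_forall fun x => ?_)
    rcases eq_or_ne x 0 with rfl | hx
    · simp
    · have : ‖x‖ ≠ 0 := by simpa using hx
      simp [abs_mul]
      field_simp
  rw [h1, h3] at h
  rw [h, areaMeasure]
  simp

theorem integral_abs_inner (u : E3) :
    ∫ n, |inner ℝ n.1 u| ∂areaMeasure = 2 * Real.pi * ‖u‖ := by
  let w : E3 := EuclideanSpace.single 2 ‖u‖
  have hw : ‖u‖ = ‖w‖ := by simp [w]
  -- Since `‖u‖ = ‖w‖`, this reflection carries `u` to the multiple `w` of the last basis vector.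
  let R := (ℝ ∙ (u - w))ᗮ.reflection
  have hR : R u = w := Submodule.reflection_sub hw
  have h := integral_sphere_comp_isometry R (fun x : E3 => |inner ℝ x w|)
  have h1 : ∀ n : E3, inner ℝ (R n) w = inner ℝ n u := by
    intro n; rw [← hR, R.inner_map_map]
  simp only [h1] at h
  rw [areaMeasure, h]
  have h2 : ∀ n : E3, |inner ℝ n w| = ‖u‖ * |n 2| := by
    intro n; simp [w, EuclideanSpace.inner_single_right, abs_mul]
  simp only [h2]
  rw [integral_const_mul, ← areaMeasure, integral_abs_coord, mul_comm]

theorem measurable_real_sign : Measurable Real.sign := by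
  unfold Real.sign
  exact Measurable.ite measurableSet_Iio measurable_const
    (Measurable.ite measurableSet_Ioi measurable_const measurable_const)

theorem abs_real_sign_le_one (x : ℝ) : |Real.sign x| ≤ 1 := by
  rcases Real.sign_apply_eq x with h | h | h <;> simp [h]

instance : IsFiniteMeasure areaMeasure := by unfold areaMeasure; infer_instance

theorem integrable_sign_inner_smul (e : E3) :
    Integrable (fun n : BlochSphere => (inner ℝ n.1 e : ℝ).sign • n.1) areaMeasure := by
  refine Integrable.of_bound (C := 1) ?_ (.of_forall fun n => ?_)
  · exact ((measurable_real_sign.comp (by fun_prop)).smul measurable_subtype_coe).aestronglyMeasurable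
  · rw [norm_smul, norm_eq_of_mem_sphere, mul_one]
    exact abs_real_sign_le_one _

/-- The reflection across the line `ℝe` fixes the integral, which is therefore a multiple of `e`;
pairing with `e` turns the integrand into `|⟨n, e⟩|` and gives the coefficient. -/
theorem integral_sign_inner_smul {e : E3} (he : ‖e‖ = 1) :
    ∫ n, (inner ℝ n.1 e : ℝ).sign • n.1 ∂areaMeasure = (2 * Real.pi) • e := by
  set v := ∫ n, (inner ℝ n.1 e : ℝ).sign • n.1 ∂areaMeasure with hv
  let R := (ℝ ∙ e).reflection
  have hRe : R e = e :=
    Submodule.reflection_mem_subspace_eq_self (Submodule.mem_span_singleton_self e)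
  have hRv : R v = v := by
    have h := integral_sphere_comp_isometry R (fun x : E3 => (inner ℝ x e : ℝ).sign • x)
    have h1 : ∀ n : E3, inner ℝ (R n) e = inner ℝ n e := by
      intro n
      conv_lhs => rw [← hRe]
      rw [R.inner_map_map]
    simp only [h1, ← map_smul] at h
    rw [← areaMeasure] at h
    exact (R.toContinuousLinearEquiv.toContinuousLinearMap.integral_comp_comm
      (integrable_sign_inner_smul e)).symm.trans h
  obtain ⟨c, hc⟩ := Submodule.mem_span_singleton.1 (Submodule.reflection_eq_self_iff v |>.1 hRv)
  have hve : inner ℝ v e = 2 * Real.pi := by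
    have h := (innerSL ℝ e).integral_comp_comm (integrable_sign_inner_smul e)
    simp only [innerSL_apply_apply, inner_smul_right] at h
    rw [real_inner_comm, hv, ← h]
    have h2 := integral_abs_inner e
    rw [he, mul_one] at h2
    rw [← h2]
    refine integral_congr_ae (.of_forall fun n => ?_)
    beta_reduce
    rw [real_inner_comm n.1 e]
    rcases lt_trichotomy (inner ℝ n.1 e : ℝ) 0 with h | h | h
    · simp [Real.sign_of_neg h, abs_of_neg h]
    · simp [h]
    · simp [Real.sign_of_pos h, abs_of_pos h]
  rw [← hc, inner_smul_left, real_inner_self_eq_norm_sq, he] at hve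
  simp at hve
  rw [← hc, hve]

/-- Integration of a function homogeneous of degree one, pulled back by a linear map, against
the corresponding weight of degree `-4`. -/
theorem integral_weight_smul_comp_symm (D : E3 ≃L[ℝ] E3) {F : Type*} [NormedAddCommGroup F]
    [NormedSpace ℝ F] [CompleteSpace F] {g : E3 → F} (hg : StronglyMeasurable g) {C : ℝ}
    (hC : ∀ x, ‖g x‖ ≤ C * ‖x‖) (hom : ∀ r : ℝ, 0 < r → ∀ x, g (r • x) = r • g x) :
    ∫ n, (‖D.symm n.1‖ ^ 4)⁻¹ • g (D.symm n.1) ∂areaMeasure =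
      |LinearMap.det (D : E3 →ₗ[ℝ] E3)| • ∫ n, g n.1 ∂areaMeasure := by
  have hdet : LinearMap.det (D.symm : E3 →ₗ[ℝ] E3) = (LinearMap.det (D : E3 →ₗ[ℝ] E3))⁻¹ := by
    have h := LinearEquiv.det_symm_mul_det D.toLinearEquiv
    exact eq_inv_of_mul_eq_one_left h
  -- `‖x‖⁻⁴ g(x)` has degree `-3`, minus the dimension, and restricts to `g` on the unit sphere.
  have h := integral_sphere_comp_linear (volume : Measure E3) D.symm
    (f := fun x => (‖x‖ ^ 4)⁻¹ • g x) (C := |C|) ?_ ?_ ?_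
  · rw [hdet, abs_inv, inv_inv] at h
    rw [areaMeasure, h]
    congr 1
    refine integral_congr_ae (.of_forall fun n => ?_)
    simp
  · exact (by fun_prop : Measurable fun x : E3 => (‖x‖ ^ 4)⁻¹).stronglyMeasurable.smul hg
  · intro x
    rcases eq_or_ne x 0 with rfl | hx
    · simp
    have hx : 0 < ‖x‖ := norm_pos_iff.2 hx
    have := (hC x).trans (mul_le_mul_of_nonneg_right (le_abs_self C) hx.le)
    rw [norm_smul]
    simp only [finrank_euclideanSpace, Fintype.card_fin, norm_inv, norm_pow, norm_norm]
    calc _ = ‖g x‖ / ‖x‖ := by field_simp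
      _ ≤ |C| := by rwa [div_le_iff₀ hx]
  · intro r hr x
    simp only [hom r hr, norm_smul, Real.norm_of_nonneg hr.le, smul_smul,
      finrank_euclideanSpace, Fintype.card_fin]
    congr 1
    field_simp

/-! ### Bloch coordinates for qubit operators -/

/-- The hermitian operator `(t + v · σ) / 2`. -/
def bloch (t : ℝ) (v : E3) : Op :=
  (1 / 2 : ℂ) • ((t : ℂ) • (1 : Op) + ∑ i : Fin 3, (v i : ℂ) • pauli i)

theorem bloch_eq (t : ℝ) (v : E3) :
    bloch t v = !![((t : ℂ) + v 2) / 2, (v 0 - v 1 * Complex.I) / 2;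
      (v 0 + v 1 * Complex.I) / 2, ((t : ℂ) - v 2) / 2] := by
  ext i j
  fin_cases i <;> fin_cases j <;>
    simp [bloch, pauli, Fin.sum_univ_three] <;> ring

theorem pureState_eq_bloch (n : BlochSphere) : pureState n = bloch 1 n.1 := by
  simp [pureState, bloch]

theorem bloch_two_zero : bloch 2 0 = 1 := by
  simp [bloch]

theorem smul_bloch (r t : ℝ) (v : E3) : r • bloch t v = bloch (r * t) (r • v) := by
  ext i j
  fin_cases i <;> fin_cases j <;> simp [bloch_eq] <;> ring

theorem bloch_sub (t s : ℝ) (v w : E3) : bloch t v - bloch s w = bloch (t - s) (v - w) := by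
  ext i j
  fin_cases i <;> fin_cases j <;> simp [bloch_eq] <;> ring

theorem bloch_add (t s : ℝ) (v w : E3) : bloch t v + bloch s w = bloch (t + s) (v + w) := by
  ext i j
  fin_cases i <;> fin_cases j <;> simp [bloch_eq] <;> ring

theorem trace_bloch (t : ℝ) (v : E3) : (bloch t v).trace = t := by
  simp [bloch_eq, Matrix.trace_fin_two]; ring

theorem bloch_isHermitian (t : ℝ) (v : E3) : (bloch t v).IsHermitian := by
  ext i j
  fin_cases i <;> fin_cases j <;>
    simp [bloch_eq, Matrix.conjTranspose_apply, Complex.ext_iff]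

/-- The real part of the trace. -/
def traceCoord (A : Op) : ℝ := (A 0 0).re + (A 1 1).re

/-- The Bloch vector of an operator. -/
def blochVector (A : Op) : E3 := !₂[2 * (A 1 0).re, 2 * (A 1 0).im, (A 0 0).re - (A 1 1).re]

theorem traceCoord_bloch (t : ℝ) (v : E3) : traceCoord (bloch t v) = t := by
  simp [traceCoord, bloch_eq]; ring

theorem blochVector_bloch (t : ℝ) (v : E3) : blochVector (bloch t v) = v := by
  ext i
  fin_cases i <;> simp [blochVector, bloch_eq] <;> ring

theorem bloch_traceCoord_blochVector {A : Op} (hA : A.IsHermitian) :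
    bloch (traceCoord A) (blochVector A) = A := by
  have h00 : (A 0 0).im = 0 := by
    have := congrArg Complex.im (hA.apply 0 0)
    simp at this; linarith
  have h11 : (A 1 1).im = 0 := by
    have := congrArg Complex.im (hA.apply 1 1)
    simp at this; linarith
  have h01 := hA.apply 0 1
  ext i j
  fin_cases i <;> fin_cases j <;>
    simp [bloch_eq, traceCoord, blochVector, ← h01, Complex.ext_iff, h00, h11] <;> ring

theorem bloch_inj {t s : ℝ} {v w : E3} : bloch t v = bloch s w ↔ t = s ∧ v = w := by
  refine ⟨fun h => ⟨?_, ?_⟩, fun h => by rw [h.1, h.2]⟩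
  · rw [← traceCoord_bloch t v, h, traceCoord_bloch]
  · rw [← blochVector_bloch t v, h, blochVector_bloch]

theorem continuous_blochVector : Continuous blochVector := by
  unfold blochVector
  refine (PiLp.continuous_toLp 2 _).comp (continuous_pi fun i => ?_)
  fin_cases i <;> simp <;> fun_prop

theorem continuous_bloch (t : ℝ) : Continuous (bloch t) := by
  unfold bloch
  fun_prop

theorem norm_sq_eq_three (v : E3) : ‖v‖ ^ 2 = v 0 ^ 2 + v 1 ^ 2 + v 2 ^ 2 := by
  simp [EuclideanSpace.norm_sq_eq, Fin.sum_univ_three]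

theorem bloch_mul_self (t : ℝ) (v : E3) :
    bloch t v * bloch t v = bloch ((t ^ 2 + ‖v‖ ^ 2) / 2) (t • v) := by
  rw [norm_sq_eq_three]
  have hI := Complex.I_sq
  ext i j
  fin_cases i <;> fin_cases j <;>
    simp [bloch_eq, Matrix.mul_apply, Fin.sum_univ_two] <;> ring_nf <;> simp [hI] <;> ring

theorem isStarProjection_bloch_one {v : E3} (hv : ‖v‖ = 1) : IsStarProjection (bloch 1 v) := by
  refine ⟨?_, bloch_isHermitian 1 v⟩
  rw [IsIdempotentElem, bloch_mul_self, hv]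
  norm_num

/-- For `v ≠ 0` the operator is `‖v‖` times a projection plus `(t - ‖v‖)/2` times the identity. -/
theorem posSemidef_bloch_of_norm_le {t : ℝ} {v : E3} (h : ‖v‖ ≤ t) : (bloch t v).PosSemidef := by
  have hone : ∀ s : ℝ, 0 ≤ s → (bloch s 0).PosSemidef := by
    intro s hs
    have : bloch s 0 = (s / 2) • (1 : Op) := by
      rw [← bloch_two_zero, smul_bloch]; simp
    rw [this]
    exact Matrix.PosSemidef.one.smul (by positivity)
  rcases eq_or_ne v 0 with rfl | hv
  · exact hone t (by simpa using h)
  have hv : 0 < ‖v‖ := norm_pos_iff.2 hv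
  have h1 : (bloch 1 (‖v‖⁻¹ • v)).PosSemidef := by
    have hp := isStarProjection_bloch_one (v := ‖v‖⁻¹ • v) (by simp [norm_smul, hv.ne'])
    rw [← hp.isIdempotentElem.eq]
    nth_rw 1 [← (bloch_isHermitian 1 (‖v‖⁻¹ • v)).eq]
    exact Matrix.posSemidef_conjTranspose_mul_self _
  have : bloch t v = ‖v‖ • bloch 1 (‖v‖⁻¹ • v) + bloch (t - ‖v‖) 0 := by
    rw [smul_bloch, bloch_add, smul_smul, mul_inv_cancel₀ hv.ne']
    simp
  rw [this]
  exact (h1.smul hv.le).add (hone _ (by linarith))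

theorem det_bloch (t : ℝ) (v : E3) : (bloch t v).det = ((t ^ 2 - ‖v‖ ^ 2) / 4 : ℝ) := by
  rw [norm_sq_eq_three, bloch_eq, Matrix.det_fin_two_of]
  push_cast
  ring_nf
  simp
  ring

theorem norm_le_of_posSemidef_bloch {t : ℝ} {v : E3} (h : (bloch t v).PosSemidef) : ‖v‖ ≤ t := by
  have h1 := h.det_nonneg
  have h2 := h.trace_nonneg
  rw [det_bloch] at h1
  rw [trace_bloch] at h2
  have h1 : 0 ≤ (t ^ 2 - ‖v‖ ^ 2) / 4 := by exact_mod_cast h1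
  have h2 : 0 ≤ t := by exact_mod_cast h2
  exact abs_le_of_sq_le_sq' (by linarith) h2 |>.2

theorem mem_blochHyperplane_iff {A : Op} : A ∈ blochHyperplane ↔ ∃ v, A = bloch 1 v := by
  refine ⟨fun h => ⟨blochVector A, ?_⟩, ?_⟩
  · have h1 := bloch_traceCoord_blochVector h.1
    have h2 : traceCoord A = 1 := by
      have := congrArg Complex.re h.2
      simpa [Matrix.trace_fin_two, traceCoord] using this
    rw [← h2, h1]
  · rintro ⟨v, rfl⟩
    exact ⟨bloch_isHermitian 1 v, by simp [trace_bloch]⟩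

theorem mem_blochBall_iff {A : Op} : A ∈ blochBall ↔ ∃ v : E3, ‖v‖ ≤ 1 ∧ A = bloch 1 v := by
  refine ⟨fun h => ?_, ?_⟩
  · obtain ⟨v, rfl⟩ := mem_blochHyperplane_iff.1 h.1
    exact ⟨v, norm_le_of_posSemidef_bloch h.2.1, rfl⟩
  · rintro ⟨v, hv, rfl⟩
    refine ⟨mem_blochHyperplane_iff.2 ⟨v, rfl⟩, posSemidef_bloch_of_norm_le hv, ?_⟩
    rw [← bloch_two_zero, bloch_sub]
    exact posSemidef_bloch_of_norm_le (by norm_num [hv])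

/-- Idempotency reads `(t² + ‖v‖²)/2 = t` and `tv = v`: either `v = 0` and `t ∈ {0, 2}`, or `t = 1`
and `‖v‖ = 1`. -/
theorem isStarProjection_cases {P : Op} (hP : IsStarProjection P) :
    P = 0 ∨ P = 1 ∨ ∃ v : E3, ‖v‖ = 1 ∧ P = bloch 1 v := by
  obtain ⟨t, v, rfl⟩ : ∃ t v, P = bloch t v :=
    ⟨_, _, (bloch_traceCoord_blochVector hP.isSelfAdjoint).symm⟩
  have h := hP.isIdempotentElem.eq
  rw [bloch_mul_self, bloch_inj] at h
  obtain ⟨h1, h2⟩ := h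
  rcases eq_or_ne v 0 with rfl | hv
  · have : t * (t - 2) = 0 := by simp at h1; linarith
    rcases mul_eq_zero.1 this with h | h
    · left; rw [h]; simp [bloch]
    · right; left; rw [← bloch_two_zero, sub_eq_zero.1 h]
  · have ht : t = 1 := by
      have : (t - 1) • v = 0 := by rw [sub_smul, h2]; simp
      rcases smul_eq_zero.1 this with h | h
      · linarith
      · exact absurd h hv
    subst ht
    refine .inr (.inr ⟨v, ?_, rfl⟩)
    have : ‖v‖ ^ 2 = 1 := by linarith
    exact (pow_eq_one_iff_of_nonneg (norm_nonneg _) two_ne_zero).1 this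

/-! ### Operator integrals, the EPR map and the box in Bloch coordinates -/

theorem opIntegral_bloch {Λ : Type} [MeasurableSpace Λ] {ν : Measure Λ} {b₀ : Λ → ℝ} {b : Λ → E3}
    (h₀ : Integrable b₀ ν) (h : Integrable b ν) :
    opIntegral ν (fun x => bloch (b₀ x) (b x)) = bloch (∫ x, b₀ x ∂ν) (∫ x, b x ∂ν) := by
  have hi : ∀ i, Integrable (fun x => b x i) ν := fun i =>
    (EuclideanSpace.proj (𝕜 := ℝ) i).integrable_comp h
  have hb : ∀ i, (∫ x, b x ∂ν) i = ∫ x, b x i ∂ν := fun i =>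
    ((EuclideanSpace.proj (𝕜 := ℝ) i).integral_comp_comm h).symm
  have h₀' := h₀.ofReal (𝕜 := ℂ)
  have hi' := fun i => (hi i).ofReal (𝕜 := ℂ)
  simp only [Complex.coe_algebraMap] at h₀' hi'
  ext i j
  fin_cases i <;> fin_cases j <;> simp only [opIntegral, bloch_eq, Matrix.of_apply, Fin.zero_eta,
    Fin.mk_one, Matrix.cons_val', Matrix.cons_val_zero, Matrix.cons_val_one,
    Matrix.cons_val_fin_one, integral_div, hb]
  · rw [integral_add h₀' (hi' 2), integral_complex_ofReal, integral_complex_ofReal]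
  · rw [integral_sub (hi' 0) ((hi' 1).mul_const _), integral_mul_const, integral_complex_ofReal,
      integral_complex_ofReal]
  · rw [integral_add (hi' 0) ((hi' 1).mul_const _), integral_mul_const, integral_complex_ofReal,
      integral_complex_ofReal]
  · rw [integral_sub h₀' (hi' 2), integral_complex_ofReal, integral_complex_ofReal]

theorem integrable_traceCoord {Λ : Type} [MeasurableSpace Λ] {ν : Measure Λ} {B : Λ → Op}
    (h : OpIntegrable B ν) : Integrable (fun x => traceCoord (B x)) ν :=
  (h 0 0).re.add (h 1 1).re

theorem integrable_blochVector {Λ : Type} [MeasurableSpace Λ] {ν : Measure Λ} {B : Λ → Op}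
    (h : OpIntegrable B ν) : Integrable (fun x => blochVector (B x)) ν := by
  refine ((EuclideanSpace.equiv (Fin 3) ℝ).symm.toContinuousLinearMap.integrable_comp
    (φ := fun x => ![2 * (B x 1 0).re, 2 * (B x 1 0).im, (B x 0 0).re - (B x 1 1).re])
    (Integrable.of_eval fun i => ?_))
  fin_cases i
  · exact (h 1 0).re.const_mul 2
  · exact (h 1 0).im.const_mul 2
  · exact (h 0 0).re.sub (h 1 1).re

/-- The transpose appears because the first index of `T` belongs to Alice and is contracted with
`v`. -/
theorem eprMap_tState_bloch (T : Matrix (Fin 3) (Fin 3) ℝ) (t : ℝ) (v : E3) :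
    eprMap (tState T) (bloch t v) = bloch (t / 2) ((1 / 2 : ℝ) • T.transpose.toEuclideanLin v) := by
  have hI := Complex.I_sq
  ext k l
  fin_cases k <;> fin_cases l <;>
    simp [eprMap, partialTraceA, tState, Matrix.mul_apply, Fintype.sum_prod_type, bloch_eq, pauli,
      Fin.sum_univ_three, Matrix.one_apply, Matrix.toLpLin_apply, Matrix.mulVec,
      dotProduct] <;> ring_nf <;> simp [hI] <;> ring

theorem integrable_smul_sphere {μ : Measure BlochSphere} [IsFiniteMeasure μ] {g : BlochSphere → ℝ}
    (hg : Measurable g) (hg1 : ∀ n, |g n| ≤ 1) : Integrable (fun n => g n • n.1) μ := by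
  refine Integrable.of_bound (C := 1) ?_ (.of_forall fun n => ?_)
  · exact (hg.smul measurable_subtype_coe).aestronglyMeasurable
  · rw [norm_smul, norm_eq_of_mem_sphere, mul_one]
    exact hg1 n

theorem mem_box_iff {μ : Measure BlochSphere} [IsFiniteMeasure μ] {M : Op} :
    M ∈ box μ ↔ ∃ g : BlochSphere → ℝ, Measurable g ∧ (∀ n, 0 ≤ g n ∧ g n ≤ 1) ∧
      M = bloch (∫ n, g n ∂μ) (∫ n, g n • n.1 ∂μ) := by
  refine exists_congr fun g => and_congr_right fun hg => and_congr_right fun h01 => ?_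
  have hg1 : ∀ n, |g n| ≤ 1 := fun n => abs_le.2 ⟨by linarith [(h01 n).1], (h01 n).2⟩
  rw [← opIntegral_bloch (Integrable.of_bound hg.aestronglyMeasurable 1 (.of_forall hg1))
    (integrable_smul_sphere hg hg1)]
  simp only [pureState_eq_bloch, smul_bloch, mul_one]

/-! ### Steering ellipsoid, gauge distance and principal radius -/

/-- `ρ` has maximally mixed marginals, and `A ↦ A'` acts on Bloch vectors as `D / 2`. -/
def HasBlochMap (ρ : Op₂) (D : E3 ≃L[ℝ] E3) : Prop :=
  ∀ t v, eprMap ρ (bloch t v) = bloch (t / 2) ((1 / 2 : ℝ) • D v)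

/-- The point of the steering hyperplane with Bloch vector `D a / 2`. -/
def steeringPoint (D : E3 ≃L[ℝ] E3) (a : E3) : Op := bloch (1 / 2) ((1 / 2 : ℝ) • D a)

variable {ρ : Op₂} {D : E3 ≃L[ℝ] E3}

theorem HasBlochMap.eprMap_one (h : HasBlochMap ρ D) : eprMap ρ 1 = bloch 1 0 := by
  rw [← bloch_two_zero, h]; simp

theorem HasBlochMap.isAnsatz_iff (h : HasBlochMap ρ D) {μ : Measure BlochSphere} :
    IsAnsatz ρ μ ↔ IsProbabilityMeasure μ ∧ ∫ n, n.1 ∂μ = 0 := by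
  refine and_congr_right fun hμ => ?_
  have hint : Integrable (fun n : BlochSphere => n.1) μ := by
    simpa using integrable_smul_sphere (μ := μ) (measurable_const (a := (1 : ℝ))) (by simp)
  have := opIntegral_bloch (integrable_const (μ := μ) (1 : ℝ)) hint
  simp only [← pureState_eq_bloch] at this
  rw [this, h.eprMap_one, bloch_inj]
  simp

theorem HasBlochMap.steeringHyperplane_eq (h : HasBlochMap ρ D) :
    steeringHyperplane ρ = Set.range (steeringPoint D) := by
  ext M
  simp only [steeringHyperplane, Set.mem_image, mem_blochHyperplane_iff, Set.mem_range]
  constructor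
  · rintro ⟨_, ⟨v, rfl⟩, rfl⟩
    exact ⟨v, (h 1 v).symm⟩
  · rintro ⟨v, rfl⟩
    exact ⟨_, ⟨v, rfl⟩, h 1 v⟩

theorem HasBlochMap.steeringBall_eq (h : HasBlochMap ρ D) :
    steeringBall ρ = steeringPoint D '' Metric.closedBall 0 1 := by
  ext M
  simp only [steeringBall, Set.mem_image, mem_blochBall_iff, mem_closedBall_zero_iff]
  constructor
  · rintro ⟨_, ⟨v, hv, rfl⟩, rfl⟩
    exact ⟨v, hv, (h 1 v).symm⟩
  · rintro ⟨v, hv, rfl⟩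
    exact ⟨_, ⟨v, hv, rfl⟩, h 1 v⟩

theorem HasBlochMap.steeringCentre_eq (h : HasBlochMap ρ D) :
    steeringCentre ρ = steeringPoint D 0 := by
  rw [steeringCentre, h.eprMap_one, smul_bloch, steeringPoint]; simp

theorem HasBlochMap.steeringDist_eq (h : HasBlochMap ρ D) (a : E3) :
    steeringDist ρ (steeringPoint D a) (steeringCentre ρ) = ‖a‖ := by
  have hset : {r : ℝ | r ∈ Set.Ioi (0 : ℝ) ∧ r⁻¹ • (steeringPoint D a - steeringCentre ρ) ∈
      (fun X => X - steeringCentre ρ) '' steeringBall ρ} = {r : ℝ | 0 < r ∧ ‖a‖ ≤ r} := by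
    ext r
    refine and_congr_right fun (hr : 0 < r) => ?_
    have h1 : ‖a‖ ≤ r ↔ ‖r⁻¹ • a‖ ≤ 1 := by
      rw [norm_smul, norm_inv, Real.norm_of_nonneg hr.le, inv_mul_le_iff₀ hr, mul_one]
    rw [h1, h.steeringBall_eq, h.steeringCentre_eq]
    simp only [steeringPoint, Set.mem_image, exists_exists_and_eq_and, bloch_sub, smul_bloch,
      bloch_inj, mem_closedBall_zero_iff, map_zero, smul_zero, sub_zero, sub_self, mul_zero,
      true_and]
    constructor
    · rintro ⟨b, hb, hab⟩
      rw [smul_comm r⁻¹, ← map_smul D r⁻¹] at hab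
      rwa [← D.injective (smul_right_injective E3 (by norm_num : (1 / 2 : ℝ) ≠ 0) hab)]
    · intro hb
      exact ⟨_, hb, by rw [smul_comm r⁻¹, map_smul]⟩
  rw [steeringDist, gauge_def', hset]
  -- The gauge only ranges over `r > 0`, so at `a = 0` the infimum is not attained; hence the `ε`.
  refine le_antisymm (le_of_forall_pos_le_add fun ε hε => ?_) ?_
  · exact csInf_le ⟨0, fun r hr => hr.1.le⟩ ⟨by positivity, by linarith⟩
  · exact le_csInf ⟨‖a‖ + 1, by positivity, by linarith⟩ fun r hr => hr.2

theorem continuous_steeringPoint (D : E3 ≃L[ℝ] E3) : Continuous (steeringPoint D) :=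
  (continuous_bloch _).comp (by fun_prop)

/-- On a segment leaving the set `K` from the centre there is a relative boundary point. -/
theorem HasBlochMap.exists_mem_relBoundary (h : HasBlochMap ρ D) {K : Set Op} {e : E3} {s : ℝ}
    (hs : 0 ≤ s) (h0 : steeringPoint D 0 ∈ K) (h1 : steeringPoint D (s • e) ∉ K) :
    ∃ r ≤ s, 0 ≤ r ∧ steeringPoint D (r • e) ∈ relBoundary (steeringHyperplane ρ) K := by
  let γ : ℝ → steeringHyperplane ρ := fun t =>
    ⟨steeringPoint D (t • e), h.steeringHyperplane_eq ▸ ⟨_, rfl⟩⟩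
  have hγ : Continuous γ := ((continuous_steeringPoint D).comp (by fun_prop)).subtype_mk _
  have hconn : IsPreconnected (γ '' Set.Icc 0 s) := isPreconnected_Icc.image γ hγ.continuousOn
  obtain ⟨_, ⟨t, ht, rfl⟩, hfr⟩ := inter_frontier_nonempty_of_isPreconnected hconn
    (t := (Subtype.val : steeringHyperplane ρ → Op) ⁻¹' K)
    ⟨γ 0, ⟨0, ⟨le_rfl, hs⟩, rfl⟩, by simpa [γ] using h0⟩
    ⟨γ s, ⟨s, ⟨hs, le_rfl⟩, rfl⟩, by simpa [γ] using h1⟩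
  exact ⟨t, ht.2, ht.1, _, hfr, rfl⟩

theorem HasBlochMap.bddBelow_steeringDist (h : HasBlochMap ρ D) (K : Set Op) :
    BddBelow ((fun B => steeringDist ρ B (steeringCentre ρ)) ''
      relBoundary (steeringHyperplane ρ) K) := by
  refine ⟨0, ?_⟩
  rintro _ ⟨_, ⟨⟨M, hM⟩, -, rfl⟩, rfl⟩
  rw [h.steeringHyperplane_eq] at hM
  obtain ⟨a, rfl⟩ := hM
  simp only [h.steeringDist_eq]
  exact norm_nonneg a

theorem HasBlochMap.principalRadius_le (h : HasBlochMap ρ D) {μ : Measure BlochSphere} {e : E3}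
    {s : ℝ} (he : ‖e‖ = 1) (hs : 0 ≤ s) (h0 : steeringPoint D 0 ∈ box μ)
    (h1 : steeringPoint D (s • e) ∉ box μ) : principalRadius ρ μ ≤ s := by
  obtain ⟨r, hrs, hr, hmem⟩ := h.exists_mem_relBoundary hs h0 h1
  refine (csInf_le (h.bddBelow_steeringDist _) ⟨_, hmem, rfl⟩).trans ?_
  simp only [h.steeringDist_eq]
  rwa [norm_smul, he, mul_one, Real.norm_of_nonneg hr]

/-- An open ball around the centre that lies in the box consists of relative interior points, so it
contains no boundary point. Nonemptiness matters because `sInf ∅ = 0`. -/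
theorem HasBlochMap.le_principalRadius (h : HasBlochMap ρ D) {μ : Measure BlochSphere} {c : ℝ}
    (hne : (relBoundary (steeringHyperplane ρ) (box μ)).Nonempty)
    (hc : ∀ a, ‖a‖ < c → steeringPoint D a ∈ box μ) : c ≤ principalRadius ρ μ := by
  refine le_csInf (hne.image _) ?_
  rintro _ ⟨_, ⟨⟨M, hM⟩, hfr, rfl⟩, rfl⟩
  have hM' := hM
  rw [h.steeringHyperplane_eq] at hM'
  obtain ⟨a, rfl⟩ := hM'
  simp only [h.steeringDist_eq]
  by_contra! hlt
  -- A continuous function recovering `‖a‖` from the point with parameter `a`; it makes the ball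
  -- relatively open.
  let f : steeringHyperplane ρ → ℝ := fun X => ‖D.symm ((2 : ℝ) • blochVector X.1)‖
  have hf : ∀ b (hb : steeringPoint D b ∈ steeringHyperplane ρ), f ⟨_, hb⟩ = ‖b‖ := by
    intro b hb
    simp [f, steeringPoint, blochVector_bloch, smul_smul]
  have hfc : Continuous f := by
    have := continuous_blochVector.comp (continuous_subtype_val (p := (· ∈ steeringHyperplane ρ)))
    exact (D.symm.continuous.comp (this.const_smul (2 : ℝ))).norm
  have hint : (⟨_, hM⟩ : steeringHyperplane ρ) ∈
      interior ((Subtype.val : steeringHyperplane ρ → Op) ⁻¹' box μ) := by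
    refine mem_interior.2 ⟨f ⁻¹' Set.Iio c, ?_, isOpen_Iio.preimage hfc, by simpa [hf] using hlt⟩
    rintro ⟨X, hX⟩ hXc
    have hX' := hX
    rw [h.steeringHyperplane_eq] at hX'
    obtain ⟨b, rfl⟩ := hX'
    rw [Set.mem_preimage, hf] at hXc
    exact hc b hXc
  exact hfr.2 hint

/-! ### The upper bound on all local models -/

theorem integrable_norm_comp (D : E3 ≃L[ℝ] E3) :
    Integrable (fun n : BlochSphere => ‖D n.1‖) areaMeasure :=
  (by fun_prop : Continuous fun n : BlochSphere => ‖D n.1‖).integrable_of_hasCompactSupport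
    (HasCompactSupport.of_compactSpace _)

theorem integral_norm_comp_pos (D : E3 ≃L[ℝ] E3) : 0 < ∫ n, ‖D n.1‖ ∂areaMeasure := by
  rw [integral_pos_iff_support_of_nonneg (fun n => norm_nonneg _) (integrable_norm_comp D)]
  have : Function.support (fun n : BlochSphere => ‖D n.1‖) = Set.univ := by
    ext n
    simp [Metric.ne_of_mem_sphere n.2 one_ne_zero]
  rw [this, Measure.measure_univ_pos]
  exact Measure.toSphere_ne_zero _

/-- Integrate the hypothesis over the sphere and exchange the integrals: each vector `b x` then
contributes `2π‖b x‖`, whatever its direction. -/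
theorem mul_integral_norm_le {Λ : Type*} [MeasurableSpace Λ] {ν : Measure Λ} [IsFiniteMeasure ν]
    {b : Λ → E3} (hb : Integrable b ν) {s : ℝ}
    (h : ∀ u : BlochSphere, s * ‖D u.1‖ ≤ ∫ x, |inner ℝ (b x) u.1| ∂ν) :
    s * ∫ u, ‖D u.1‖ ∂areaMeasure ≤ 2 * Real.pi * ∫ x, ‖b x‖ ∂ν := by
  have hint : Integrable (fun p : BlochSphere × Λ => |inner ℝ (b p.2) p.1.1|)
      (areaMeasure.prod ν) := by
    refine (hb.norm.comp_snd areaMeasure).mono' ?_ (.of_forall fun p => ?_)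
    · have h1 : AEStronglyMeasurable (fun p : BlochSphere × Λ => p.1.1) (areaMeasure.prod ν) :=
        (measurable_subtype_coe.comp measurable_fst).aestronglyMeasurable
      exact (hb.aestronglyMeasurable.comp_snd.inner (𝕜 := ℝ) h1).norm
    · simpa using abs_real_inner_le_norm (b p.2) p.1.1
  calc s * ∫ u, ‖D u.1‖ ∂areaMeasure = ∫ u, s * ‖D u.1‖ ∂areaMeasure :=
        (integral_const_mul _ _).symm
    _ ≤ ∫ u, ∫ x, |inner ℝ (b x) u.1| ∂ν ∂areaMeasure :=
        integral_mono ((integrable_norm_comp D).const_mul s) hint.integral_prod_left h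
    _ = ∫ x, ∫ u, |inner ℝ (b x) u.1| ∂areaMeasure ∂ν := integral_integral_swap hint
    _ = 2 * Real.pi * ∫ x, ‖b x‖ ∂ν := by
        simp only [real_inner_comm, integral_abs_inner, integral_const_mul]

/-- As `b` has mean zero, `g` may be replaced by `g - 1/2`, whose absolute value is at most `1/2`.
-/
theorem inner_integral_smul_le {Λ : Type*} [MeasurableSpace Λ] {ν : Measure Λ}
    {b : Λ → E3} (hb : Integrable b ν) (hb0 : ∫ x, b x ∂ν = 0) {g : Λ → ℝ} (hg : Measurable g)
    (h01 : ∀ x, 0 ≤ g x ∧ g x ≤ 1) (u : E3) :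
    inner ℝ u (∫ x, g x • b x ∂ν) ≤ 1 / 2 * ∫ x, |inner ℝ (b x) u| ∂ν := by
  have hgb : Integrable (fun x => g x • b x) ν :=
    hb.bdd_smul 1 hg.aestronglyMeasurable
      (.of_forall fun x => abs_le.2 ⟨by linarith [(h01 x).1], (h01 x).2⟩)
  have h1 := (innerSL ℝ u).integral_comp_comm hgb
  have h2 := (innerSL ℝ u).integral_comp_comm hb
  have i1 := (innerSL ℝ u).integrable_comp hgb
  have i2 := (innerSL ℝ u).integrable_comp hb
  simp only [innerSL_apply_apply, hb0, inner_zero_right] at h1 h2 i1 i2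
  have i3 : Integrable (fun x => |inner ℝ (b x) u|) ν := by
    simpa only [real_inner_comm, Real.norm_eq_abs] using i2.norm
  rw [← h1, ← sub_zero (∫ x, inner ℝ u (g x • b x) ∂ν), ← mul_zero (1 / 2 : ℝ), ← h2,
    ← integral_const_mul, ← integral_const_mul, ← integral_sub i1 (i2.const_mul _)]
  refine integral_mono (i1.sub (i2.const_mul _)) (i3.const_mul _) fun x => ?_
  have hle : (g x - 1 / 2) * inner ℝ (b x) u ≤ 1 / 2 * |inner ℝ (b x) u| := by
    refine (le_abs_self _).trans ?_
    rw [abs_mul]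
    gcongr
    exact abs_le.2 ⟨by linarith [(h01 x).1], by linarith [(h01 x).2]⟩
  simp only [inner_smul_right]
  rw [real_inner_comm (b x) u]
  linarith

/-- No local ensemble with unit mean weight reproduces a steering ellipsoid of scale larger than
`2π / ∫ ‖D u‖ dS(u)`. -/
theorem mul_integral_norm_le_two_pi {Λ : Type*} [MeasurableSpace Λ] {ν : Measure Λ}
    [IsFiniteMeasure ν] (hD : ∀ u v, inner ℝ (D u) v = (inner ℝ u (D v) : ℝ)) {b : Λ → E3}
    (hb : Integrable b ν) (hb0 : ∫ x, b x ∂ν = 0) (hb1 : ∫ x, ‖b x‖ ∂ν ≤ 1) {s : ℝ}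
    (h : ∀ e : E3, ‖e‖ = 1 → ∃ g : Λ → ℝ, Measurable g ∧ (∀ x, 0 ≤ g x ∧ g x ≤ 1) ∧
      ∫ x, g x • b x ∂ν = (1 / 2 : ℝ) • D (s • e)) :
    s * ∫ u, ‖D u.1‖ ∂areaMeasure ≤ 2 * Real.pi := by
  refine (mul_integral_norm_le hb fun u => ?_).trans
    (mul_le_of_le_one_right (by positivity) hb1)
  have hu : 0 < ‖D u.1‖ := by simp [Metric.ne_of_mem_sphere u.2 one_ne_zero]
  -- This direction maximizes `⟨u, De⟩ = ⟨Du, e⟩` over unit `e`, with value `‖Du‖`.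
  obtain ⟨g, hg, h01, hgb⟩ := h (‖D u.1‖⁻¹ • D u.1) (by simp [norm_smul, hu.ne'])
  have := inner_integral_smul_le hb hb0 hg h01 u.1
  rw [hgb, inner_smul_right, ← hD, inner_smul_right, inner_smul_right,
    real_inner_self_eq_norm_sq] at this
  have h2 : s * (‖D u.1‖⁻¹ * ‖D u.1‖ ^ 2) = s * ‖D u.1‖ := by field_simp
  rw [h2] at this
  linarith

theorem IsAnsatz.steeringPoint_zero_mem_box (hρ : HasBlochMap ρ D) {μ : Measure BlochSphere}
    (hμ : IsAnsatz ρ μ) : steeringPoint D 0 ∈ box μ := by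
  obtain ⟨hp, h0⟩ := hρ.isAnsatz_iff.1 hμ
  refine mem_box_iff.2 ⟨fun _ => 1 / 2, measurable_const, fun _ => by norm_num, ?_⟩
  rw [integral_smul, h0]
  simp [steeringPoint]

theorem IsAnsatz.exists_steeringPoint_notMem_box (hρ : HasBlochMap ρ D)
    (hD : ∀ u v, inner ℝ (D u) v = (inner ℝ u (D v) : ℝ)) {μ : Measure BlochSphere}
    (hμ : IsAnsatz ρ μ) {s : ℝ} (hs : 2 * Real.pi / ∫ u, ‖D u.1‖ ∂areaMeasure < s) :
    ∃ e : E3, ‖e‖ = 1 ∧ steeringPoint D (s • e) ∉ box μ := by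
  obtain ⟨hp, h0⟩ := hρ.isAnsatz_iff.1 hμ
  by_contra! hall
  rw [div_lt_iff₀ (integral_norm_comp_pos D)] at hs
  refine hs.not_ge (mul_integral_norm_le_two_pi hD (ν := μ) (b := fun n => n.1) ?_ h0 ?_
    fun e he => ?_)
  · simpa using integrable_smul_sphere (μ := μ) (measurable_const (a := (1 : ℝ))) (by simp)
  · simp
  · obtain ⟨g, hg, h01, h⟩ := mem_box_iff.1 (hall e he)
    exact ⟨g, hg, h01, (bloch_inj.1 h).2.symm⟩

theorem IsAnsatz.principalRadius_le (hρ : HasBlochMap ρ D)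
    (hD : ∀ u v, inner ℝ (D u) v = (inner ℝ u (D v) : ℝ)) {μ : Measure BlochSphere}
    (hμ : IsAnsatz ρ μ) :
    principalRadius ρ μ ≤ 2 * Real.pi / ∫ u, ‖D u.1‖ ∂areaMeasure := by
  refine le_of_forall_gt_imp_ge_of_dense fun s hs => ?_
  obtain ⟨e, he, hne⟩ := hμ.exists_steeringPoint_notMem_box hρ hD hs
  have : 0 ≤ 2 * Real.pi / ∫ u, ‖D u.1‖ ∂areaMeasure :=
    div_nonneg (by positivity) (integral_norm_comp_pos D).le
  exact hρ.principalRadius_le he (this.trans hs.le) (hμ.steeringPoint_zero_mem_box hρ) hne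

theorem IsAnsatz.relBoundary_nonempty (hρ : HasBlochMap ρ D)
    (hD : ∀ u v, inner ℝ (D u) v = (inner ℝ u (D v) : ℝ)) {μ : Measure BlochSphere}
    (hμ : IsAnsatz ρ μ) : (relBoundary (steeringHyperplane ρ) (box μ)).Nonempty := by
  obtain ⟨s, hs⟩ := exists_gt (max 0 (2 * Real.pi / ∫ u, ‖D u.1‖ ∂areaMeasure))
  obtain ⟨e, he, hne⟩ := hμ.exists_steeringPoint_notMem_box hρ hD ((le_max_right _ _).trans_lt hs)
  obtain ⟨r, -, -, hr⟩ := hρ.exists_mem_relBoundary ((le_max_left _ _).trans hs.le)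
    (hμ.steeringPoint_zero_mem_box hρ) hne
  exact ⟨_, hr⟩

/-! ### The distribution of Jevtic et al. -/

variable {T : Matrix (Fin 3) (Fin 3) ℝ}

/-- Take `g = ‖D·‖` in the weighted substitution: `g(D⁻¹n) = ‖n‖ = 1` on the sphere. -/
theorem integral_jevticWeight (hw : ∀ n, jevticWeight T n = (‖D.symm n.1‖ ^ 4)⁻¹) :
    ∫ n, jevticWeight T n ∂areaMeasure =
      |LinearMap.det (D : E3 →ₗ[ℝ] E3)| * ∫ n, ‖D n.1‖ ∂areaMeasure := by
  have h := integral_weight_smul_comp_symm D (g := fun x => ‖D x‖)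
    (by fun_prop : Continuous fun x => ‖D x‖).stronglyMeasurable
    (C := ‖(D : E3 →L[ℝ] E3)‖) (fun x => by simpa using (D : E3 →L[ℝ] E3).le_opNorm x)
    (fun r hr x => by rw [map_smul, norm_smul, Real.norm_of_nonneg hr.le, smul_eq_mul])
  simp only [smul_eq_mul, ContinuousLinearEquiv.apply_symm_apply, norm_eq_of_mem_sphere,
    mul_one] at h
  simp only [hw, h]

theorem det_ne_zero (D : E3 ≃L[ℝ] E3) : LinearMap.det (D : E3 →ₗ[ℝ] E3) ≠ 0 :=
  (LinearEquiv.isUnit_det' D.toLinearEquiv).ne_zero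

theorem jevticNorm_pos (hw : ∀ n, jevticWeight T n = (‖D.symm n.1‖ ^ 4)⁻¹) : 0 < jevticNorm T := by
  rw [jevticNorm, integral_jevticWeight hw]
  exact inv_pos.2 (mul_pos (abs_pos.2 (det_ne_zero D)) (integral_norm_comp_pos D))

theorem two_pi_mul_jevticNorm_mul_det (hw : ∀ n, jevticWeight T n = (‖D.symm n.1‖ ^ 4)⁻¹) :
    2 * Real.pi * jevticNorm T * |LinearMap.det (D : E3 →ₗ[ℝ] E3)| =
      2 * Real.pi / ∫ u, ‖D u.1‖ ∂areaMeasure := by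
  have h1 := abs_pos.2 (det_ne_zero D)
  have h2 := integral_norm_comp_pos D
  rw [jevticNorm, integral_jevticWeight hw]
  field_simp

theorem continuous_jevticWeight (hw : ∀ n, jevticWeight T n = (‖D.symm n.1‖ ^ 4)⁻¹) :
    Continuous (jevticWeight T) := by
  rw [funext hw]
  refine Continuous.inv₀ (by fun_prop) fun n => ?_
  simp [Metric.ne_of_mem_sphere n.2 one_ne_zero]

theorem jevticWeight_nonneg (T : Matrix (Fin 3) (Fin 3) ℝ) (n : BlochSphere) :
    0 ≤ jevticWeight T n :=
  inv_nonneg.2 (sq_nonneg _)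

theorem integral_jevticAnsatz (hw : ∀ n, jevticWeight T n = (‖D.symm n.1‖ ^ 4)⁻¹)
    {F : Type*} [NormedAddCommGroup F] [NormedSpace ℝ F] (f : BlochSphere → F) :
    ∫ n, f n ∂jevticAnsatz T =
      jevticNorm T • ∫ n, (‖D.symm n.1‖ ^ 4)⁻¹ • f n ∂areaMeasure := by
  have hm : Measurable fun n => (jevticNorm T * jevticWeight T n).toNNReal :=
    ((continuous_jevticWeight hw).measurable.const_mul _).real_toNNReal
  have := integral_withDensity_eq_integral_smul (μ := areaMeasure) hm f
  rw [jevticAnsatz]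
  simp only [ENNReal.ofReal]
  rw [this, ← integral_smul]
  refine integral_congr_ae (.of_forall fun n => ?_)
  simp only [NNReal.smul_def]
  rw [Real.coe_toNNReal _ (mul_nonneg (jevticNorm_pos hw).le (jevticWeight_nonneg T n)), hw,
    smul_smul]

theorem isProbabilityMeasure_jevticAnsatz (hw : ∀ n, jevticWeight T n = (‖D.symm n.1‖ ^ 4)⁻¹) :
    IsProbabilityMeasure (jevticAnsatz T) := by
  refine ⟨?_⟩
  have hN := jevticNorm_pos hw
  rw [jevticAnsatz, withDensity_apply _ MeasurableSet.univ, Measure.restrict_univ,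
    ← ofReal_integral_eq_lintegral_ofReal, integral_const_mul]
  · rw [jevticNorm, inv_mul_cancel₀, ENNReal.ofReal_one]
    exact (inv_pos.1 hN).ne'
  · exact ((continuous_jevticWeight hw).integrable_of_hasCompactSupport
      (HasCompactSupport.of_compactSpace _)).const_mul _
  · exact .of_forall fun n => mul_nonneg hN.le (jevticWeight_nonneg T n)

/-- The weight is even, so the antipodal isometry sends the integral to its negative. -/
theorem integral_jevticAnsatz_of_odd (hw : ∀ n, jevticWeight T n = (‖D.symm n.1‖ ^ 4)⁻¹)
    {F : Type*} [NormedAddCommGroup F] [NormedSpace ℝ F] {f : E3 → F}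
    (hf : ∀ x, f (-x) = -f x) : ∫ n, f n.1 ∂jevticAnsatz T = 0 := by
  rw [integral_jevticAnsatz hw]
  have h := integral_sphere_comp_isometry (LinearIsometryEquiv.neg ℝ : E3 ≃ₗᵢ[ℝ] E3)
    (fun x => (‖D.symm x‖ ^ 4)⁻¹ • f x)
  simp only [LinearIsometryEquiv.coe_neg, map_neg, norm_neg, hf, smul_neg, integral_neg] at h
  have h2 : (2 : ℝ) • ∫ n, (‖D.symm n.1‖ ^ 4)⁻¹ • f n.1 ∂areaMeasure = 0 := by
    rw [two_smul]
    nth_rw 1 [areaMeasure, ← h]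
    exact neg_add_cancel _
  rw [(smul_eq_zero_iff_right two_ne_zero).1 h2, smul_zero]

/-- The substitution `n ↦ D⁻¹n` reduces this to `D` applied to the hemisphere integral `2πe` for the
uniform measure. -/
theorem integral_sign_smul_jevticAnsatz (hw : ∀ n, jevticWeight T n = (‖D.symm n.1‖ ^ 4)⁻¹)
    {e : E3} (he : ‖e‖ = 1) :
    ∫ n, (inner ℝ (D.symm n.1) e : ℝ).sign • n.1 ∂jevticAnsatz T =
      (2 * Real.pi * jevticNorm T * |LinearMap.det (D : E3 →ₗ[ℝ] E3)|) • D e := by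
  rw [integral_jevticAnsatz hw]
  have h := integral_weight_smul_comp_symm D (g := fun x => (inner ℝ x e : ℝ).sign • D x)
    ((measurable_real_sign.comp (by fun_prop)).smul D.continuous.measurable).stronglyMeasurable
    (C := ‖(D : E3 →L[ℝ] E3)‖) (fun x => ?_) (fun r hr x => ?_)
  · simp only [ContinuousLinearEquiv.apply_symm_apply] at h
    rw [h]
    have h2 := (D : E3 →L[ℝ] E3).integral_comp_comm (integrable_sign_inner_smul e)
    simp only [ContinuousLinearEquiv.coe_coe, integral_sign_inner_smul he, map_smul] at h2
    rw [h2, smul_smul, smul_smul]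
    congr 1
    ring
  · rw [norm_smul]
    exact (mul_le_of_le_one_left (norm_nonneg _) (abs_real_sign_le_one _)).trans
      (by simpa using (D : E3 →L[ℝ] E3).le_opNorm x)
  · have : (inner ℝ (r • x) e : ℝ).sign = (inner ℝ x e : ℝ).sign := by
      rw [inner_smul_left]
      simp only [conj_trivial]
      rcases lt_trichotomy (inner ℝ x e : ℝ) 0 with h | h | h
      · rw [Real.sign_of_neg h, Real.sign_of_neg (mul_neg_of_pos_of_neg hr h)]
      · rw [h, mul_zero]
      · rw [Real.sign_of_pos h, Real.sign_of_pos (mul_pos hr h)]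
    rw [this, map_smul, smul_comm]

theorem isAnsatz_jevticAnsatz (hρ : HasBlochMap ρ D)
    (hw : ∀ n, jevticWeight T n = (‖D.symm n.1‖ ^ 4)⁻¹) : IsAnsatz ρ (jevticAnsatz T) :=
  hρ.isAnsatz_iff.2 ⟨isProbabilityMeasure_jevticAnsatz hw,
    integral_jevticAnsatz_of_odd hw (f := fun x => x) fun _ => rfl⟩

theorem steeringPoint_mem_box_jevticAnsatz
    (hw : ∀ n, jevticWeight T n = (‖D.symm n.1‖ ^ 4)⁻¹) {a : E3}
    (ha : ‖a‖ ≤ 2 * Real.pi * jevticNorm T * |LinearMap.det (D : E3 →ₗ[ℝ] E3)|) :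
    steeringPoint D a ∈ box (jevticAnsatz T) := by
  have := isProbabilityMeasure_jevticAnsatz hw
  set c := 2 * Real.pi * jevticNorm T * |LinearMap.det (D : E3 →ₗ[ℝ] E3)| with hc
  have hcpos : 0 < c := by
    have := jevticNorm_pos hw
    have := abs_pos.2 (det_ne_zero D)
    positivity
  obtain ⟨e, he, hae⟩ : ∃ e : E3, ‖e‖ = 1 ∧ a = ‖a‖ • e := by
    rcases eq_or_ne a 0 with rfl | h
    · exact ⟨EuclideanSpace.single 0 1, by simp, by simp⟩
    · have : ‖a‖ ≠ 0 := by simpa using h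
      exact ⟨‖a‖⁻¹ • a, by simp [norm_smul, this], by simp [smul_smul, this]⟩
  set t := ‖a‖ / c with ht
  have ht0 : 0 ≤ t := by positivity
  have ht1 : t ≤ 1 := (div_le_one hcpos).2 ha
  let σ : BlochSphere → ℝ := fun n => (inner ℝ (D.symm n.1) e : ℝ).sign
  have hσ : Measurable σ := measurable_real_sign.comp (by fun_prop)
  have hσ1 : ∀ n, |σ n| ≤ 1 := fun n => abs_real_sign_le_one _
  have hσi : Integrable σ (jevticAnsatz T) :=
    Integrable.of_bound hσ.aestronglyMeasurable 1 (.of_forall hσ1)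
  have hσ0 : ∫ n, σ n ∂jevticAnsatz T = 0 :=
    integral_jevticAnsatz_of_odd hw (f := fun x => (inner ℝ (D.symm x) e : ℝ).sign)
      fun x => by rw [map_neg, inner_neg_left, Real.sign_neg]
  have hn0 : ∫ n : BlochSphere, n.1 ∂jevticAnsatz T = 0 :=
    integral_jevticAnsatz_of_odd hw (f := fun x => x) fun _ => rfl
  have hni : Integrable (fun n : BlochSphere => n.1) (jevticAnsatz T) := by
    simpa using integrable_smul_sphere (μ := jevticAnsatz T)
      (measurable_const (a := (1 : ℝ))) (by simp)
  -- The extremal response is the hemisphere sign pulled back by `D⁻¹`; scaling by `t = ‖a‖/c ≤ 1`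
  -- reaches interior points. Oddness of `σ` keeps the total weight at `1/2`.
  refine mem_box_iff.2 ⟨fun n => 1 / 2 + t / 2 * σ n, by fun_prop, fun n => ?_, ?_⟩
  · have h1 := abs_le.1 (hσ1 n)
    constructor <;> nlinarith
  · rw [steeringPoint, bloch_inj]
    constructor
    · rw [integral_add (integrable_const _) (hσi.const_mul _), integral_const_mul, hσ0]
      simp
    · simp only [add_smul, mul_smul]
      have hi1 : Integrable (fun n : BlochSphere => (1 / 2 : ℝ) • n.1) (jevticAnsatz T) :=
        hni.fun_smul (1 / 2 : ℝ)
      have hi2 : Integrable (fun n : BlochSphere => (t / 2) • σ n • n.1) (jevticAnsatz T) :=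
        (integrable_smul_sphere hσ hσ1).fun_smul (t / 2)
      have hsign : ∫ n, σ n • n.1 ∂jevticAnsatz T = c • D e :=
        integral_sign_smul_jevticAnsatz hw he
      have hDa : D a = ‖a‖ • D e := by rw [← map_smul, ← hae]
      rw [integral_add hi1 hi2, integral_smul, integral_smul, hn0, hsign, smul_zero, zero_add,
        smul_smul, hDa, smul_smul, ht]
      congr 1
      field_simp

theorem principalRadius_jevticAnsatz (hρ : HasBlochMap ρ D)
    (hD : ∀ u v, inner ℝ (D u) v = (inner ℝ u (D v) : ℝ))
    (hw : ∀ n, jevticWeight T n = (‖D.symm n.1‖ ^ 4)⁻¹) :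
    principalRadius ρ (jevticAnsatz T) =
      2 * Real.pi * jevticNorm T * |LinearMap.det (D : E3 →ₗ[ℝ] E3)| := by
  have hJ := isAnsatz_jevticAnsatz hρ hw
  refine le_antisymm ?_ ?_
  · rw [two_pi_mul_jevticNorm_mul_det hw]
    exact hJ.principalRadius_le hρ hD
  · exact hρ.le_principalRadius (hJ.relBoundary_nonempty hρ hD)
      fun a ha => steeringPoint_mem_box_jevticAnsatz hw ha.le

/-! ### Steerability -/

theorem isProjectiveMeasurement_bloch {e : E3} (he : ‖e‖ = 1) :
    IsProjectiveMeasurement ![bloch 1 e, bloch 1 (-e)] := by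
  refine ⟨fun i => ?_, ?_⟩
  · fin_cases i
    · exact isStarProjection_bloch_one he
    · exact isStarProjection_bloch_one (by rwa [norm_neg])
  · simp only [Matrix.cons_val_zero, Matrix.cons_val_one]
    rw [bloch_add, ← bloch_two_zero]
    norm_num

/-- Positivity bounds the Bloch vector of each hidden state by its trace, so `∫ ‖b‖ ≤ 1`, and
rank-one measurements supply the responses for `s = 1`. -/
theorem Unsteerable.integral_norm_le (hρ : HasBlochMap ρ D)
    (hD : ∀ u v, inner ℝ (D u) v = (inner ℝ u (D v) : ℝ)) (h : Unsteerable ρ) :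
    ∫ u, ‖D u.1‖ ∂areaMeasure ≤ 2 * Real.pi := by
  obtain ⟨Λ, _, ν, B, hν, hpos, hint, h1, hG⟩ := h
  have hB : ∀ x, B x = bloch (traceCoord (B x)) (blochVector (B x)) := fun x =>
    (bloch_traceCoord_blochVector (hpos x).isHermitian).symm
  have i0 := integrable_traceCoord hint
  have i1 := integrable_blochVector hint
  have hI : opIntegral ν B = bloch (∫ x, traceCoord (B x) ∂ν) (∫ x, blochVector (B x) ∂ν) := by
    rw [← opIntegral_bloch i0 i1]
    simp only [← hB]
  rw [hI, hρ.eprMap_one, bloch_inj] at h1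
  have hle : ∫ x, ‖blochVector (B x)‖ ∂ν ≤ 1 := by
    rw [← h1.1]
    refine integral_mono i1.norm i0 fun x => norm_le_of_posSemidef_bloch ?_
    rw [← hB]
    exact hpos x
  rw [← one_mul (∫ u, ‖D u.1‖ ∂areaMeasure)]
  refine mul_integral_norm_le_two_pi hD i1 h1.2 hle fun e he => ?_
  obtain ⟨G, hGm, hG01, -, hGe⟩ := hG _ (isProjectiveMeasurement_bloch he)
  refine ⟨G 0, hGm 0, hG01 0, ?_⟩
  have hbdd : ∀ᵐ x ∂ν, ‖G 0 x‖ ≤ 1 :=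
    .of_forall fun x => abs_le.2 ⟨by linarith [(hG01 0 x).1], (hG01 0 x).2⟩
  have hI2 := opIntegral_bloch (ν := ν) (b₀ := fun x => G 0 x * traceCoord (B x))
    (b := fun x => G 0 x • blochVector (B x))
    (i0.bdd_smul 1 (hGm 0).aestronglyMeasurable hbdd)
    (i1.bdd_smul 1 (hGm 0).aestronglyMeasurable hbdd)
  simp only [← smul_bloch, ← hB] at hI2
  have h0 := hGe 0
  rw [hI2, Matrix.cons_val_zero, hρ, bloch_inj] at h0
  rw [← h0.2, one_smul]

/-- The ansatz itself serves as hidden state ensemble. Trivial projections use constant responses,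
rank-one projections the hypothesis, and the second outcome gets `1 - g`. -/
theorem unsteerable_of_ball_subset_box (hρ : HasBlochMap ρ D) {μ : Measure BlochSphere}
    (hμ : IsAnsatz ρ μ) (h : ∀ a, ‖a‖ = 1 → steeringPoint D a ∈ box μ) : Unsteerable ρ := by
  obtain ⟨hp, hμ0⟩ := hρ.isAnsatz_iff.1 hμ
  have hni : Integrable (fun n : BlochSphere => n.1) μ := by
    simpa using integrable_smul_sphere (μ := μ) (measurable_const (a := (1 : ℝ))) (by simp)
  refine ⟨BlochSphere, inferInstance, μ, pureState, hp, fun n => ?_, ?_, hμ.2, fun P hP => ?_⟩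
  · rw [pureState_eq_bloch]
    exact posSemidef_bloch_of_norm_le (norm_eq_of_mem_sphere n).le
  · have hc : Continuous fun n : BlochSphere => pureState n := by
      simp only [pureState_eq_bloch]
      exact (continuous_bloch 1).comp continuous_subtype_val
    exact fun k l => ((hc.matrix_elem k l).integrable_of_hasCompactSupport
      (HasCompactSupport.of_compactSpace _))
  obtain ⟨t, v, hP0⟩ : ∃ t v, P 0 = bloch t v :=
    ⟨_, _, (bloch_traceCoord_blochVector (hP.1 0).isSelfAdjoint).symm⟩
  have hP1 : P 1 = bloch (2 - t) (-v) := by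
    rw [eq_sub_of_add_eq' hP.2, hP0, ← bloch_two_zero, bloch_sub, zero_sub]
  obtain ⟨g, hg, h01, hgP⟩ : eprMap ρ (P 0) ∈ box μ := by
    rcases isStarProjection_cases (hP.1 0) with h0 | h0 | ⟨a, ha, h0⟩
    · refine mem_box_iff.2 ⟨fun _ => 0, measurable_const, fun _ => by simp, ?_⟩
      have : (0 : Op) = bloch 0 0 := by simp [bloch]
      rw [h0, this, hρ]
      simp
    · refine mem_box_iff.2 ⟨fun _ => 1, measurable_const, fun _ => by simp, ?_⟩
      rw [h0, hρ.eprMap_one]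
      simp [hμ0]
    · rw [h0, hρ]
      exact h a ha
  have hg1 : ∀ n, |g n| ≤ 1 := fun n => abs_le.2 ⟨by linarith [(h01 n).1], (h01 n).2⟩
  have hgi : Integrable g μ := Integrable.of_bound hg.aestronglyMeasurable 1 (.of_forall hg1)
  have hgn := integrable_smul_sphere (μ := μ) hg hg1
  have hbox := hgP
  simp only [pureState_eq_bloch, smul_bloch, mul_one] at hbox
  rw [opIntegral_bloch hgi hgn, hP0, hρ, bloch_inj] at hbox
  refine ⟨![g, fun n => 1 - g n], fun i => ?_, fun i n => ?_, fun n => by simp, fun i => ?_⟩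
  · fin_cases i
    · exact hg
    · exact measurable_const.sub hg
  · fin_cases i
    · exact h01 n
    · exact ⟨sub_nonneg.2 (h01 n).2, sub_le_self _ (h01 n).1⟩
  · fin_cases i
    · exact hgP
    · have hI := opIntegral_bloch (ν := μ) (b₀ := fun n => 1 - g n)
        (b := fun n => n.1 - g n • n.1) ((integrable_const _).sub hgi) (hni.sub hgn)
      have hp : ∀ n, bloch (1 - g n) (n.1 - g n • n.1) = (1 - g n) • pureState n := fun n => by
        rw [pureState_eq_bloch, smul_bloch, mul_one, sub_smul, one_smul]
      simp only [hp] at hI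
      simp only [Fin.mk_one, Matrix.cons_val_one, Matrix.cons_val_zero]
      rw [hI, hP1, hρ, bloch_inj,
        integral_sub (integrable_const _) hgi, integral_sub hni hgn, hμ0, ← hbox.1, ← hbox.2]
      constructor
      · simp; ring
      · simp

theorem unsteerable_iff (hρ : HasBlochMap ρ D)
    (hD : ∀ u v, inner ℝ (D u) v = (inner ℝ u (D v) : ℝ))
    (hw : ∀ n, jevticWeight T n = (‖D.symm n.1‖ ^ 4)⁻¹) :
    Unsteerable ρ ↔ 1 ≤ 2 * Real.pi * jevticNorm T * |LinearMap.det (D : E3 →ₗ[ℝ] E3)| := by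
  constructor
  · intro h
    rw [two_pi_mul_jevticNorm_mul_det hw, one_le_div (integral_norm_comp_pos D)]
    exact h.integral_norm_le hρ hD
  · intro h
    exact unsteerable_of_ball_subset_box hρ (isAnsatz_jevticAnsatz hρ hw)
      fun a ha => steeringPoint_mem_box_jevticAnsatz hw (ha.trans_le h)

/-! ### T-states -/

theorem exists_blochMap_tState {T : Matrix (Fin 3) (Fin 3) ℝ} (hsymm : T.transpose = T)
    (hdet : T.det ≠ 0) :
    ∃ D : E3 ≃L[ℝ] E3, LinearMap.det (D : E3 →ₗ[ℝ] E3) = T.det ∧ HasBlochMap (tState T) D ∧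
      (∀ u v, inner ℝ (D u) v = (inner ℝ u (D v) : ℝ)) ∧
      ∀ n, jevticWeight T n = (‖D.symm n.1‖ ^ 4)⁻¹ := by
  have hd : LinearMap.det T.toEuclideanLin = T.det := LinearMap.det_toLpLin 2 T
  let D : E3 ≃L[ℝ] E3 :=
    (LinearEquiv.ofIsUnitDet (f := T.toEuclideanLin) (v := (EuclideanSpace.basisFun (Fin 3) ℝ).toBasis)
      (v' := (EuclideanSpace.basisFun (Fin 3) ℝ).toBasis) (by
        rw [LinearMap.det_toMatrix, hd]; exact hdet.isUnit)).toContinuousLinearEquiv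
  have hDapp : ∀ v, D v = WithLp.toLp 2 (T *ᵥ v.ofLp) := fun v => rfl
  have hTu : IsUnit T.det := hdet.isUnit
  have hDs : ∀ v, D.symm v = WithLp.toLp 2 (T⁻¹ *ᵥ v.ofLp) := fun v => by
    rw [ContinuousLinearEquiv.symm_apply_eq, hDapp]
    simp [Matrix.mulVec_mulVec, Matrix.mul_nonsing_inv T hTu]
  refine ⟨D, hd, fun t v => ?_, fun u v => ?_, fun n => ?_⟩
  · rw [eprMap_tState_bloch, hsymm]
    rfl
  · simp only [hDapp, EuclideanSpace.inner_eq_star_dotProduct, star_trivial]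
    rw [Matrix.dotProduct_mulVec, ← Matrix.mulVec_transpose, hsymm, dotProduct_comm,
      dotProduct_comm]
  · have hs : (T⁻¹).transpose = T⁻¹ := by rw [Matrix.transpose_nonsing_inv, hsymm]
    -- By symmetry of `T⁻¹`, one factor moves across the dot product.
    have h2 : n.1.ofLp ⬝ᵥ ((T⁻¹ ^ 2) *ᵥ n.1.ofLp) = ‖D.symm n.1‖ ^ 2 := by
      rw [hDs, ← real_inner_self_eq_norm_sq, EuclideanSpace.inner_eq_star_dotProduct, pow_two,
        ← Matrix.mulVec_mulVec, Matrix.dotProduct_mulVec, ← Matrix.mulVec_transpose, hs]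
      simp
    rw [jevticWeight, h2, ← pow_mul]

end TwoQubit
end

theorem mainTheorem2 (T : Matrix (Fin 3) (Fin 3) ℝ) (hdiag : T.IsDiag) (hdet : T.det ≠ 0)
    (hstate : TwoQubit.IsState (TwoQubit.tState T)) :
    TwoQubit.IsAnsatz (TwoQubit.tState T) (TwoQubit.jevticAnsatz T) ∧
    TwoQubit.principalRadius (TwoQubit.tState T) (TwoQubit.jevticAnsatz T) =
      2 * Real.pi * TwoQubit.jevticNorm T * |T.det| ∧
    IsGreatest
      {r : ℝ | ∃ μ : MeasureTheory.Measure TwoQubit.BlochSphere,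
        TwoQubit.IsAnsatz (TwoQubit.tState T) μ ∧
        r = TwoQubit.principalRadius (TwoQubit.tState T) μ}
      (2 * Real.pi * TwoQubit.jevticNorm T * |T.det|) ∧
    TwoQubit.criticalRadius (TwoQubit.tState T) =
      2 * Real.pi * TwoQubit.jevticNorm T * |T.det| ∧
    (TwoQubit.Unsteerable (TwoQubit.tState T) ↔
      1 ≤ 2 * Real.pi * TwoQubit.jevticNorm T * |T.det|) := by
  obtain ⟨D, hd, hρ, hD, hw⟩ := TwoQubit.exists_blochMap_tState hdiag.isSymm hdet
  have hJ := TwoQubit.isAnsatz_jevticAnsatz hρ hw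
  have hr := TwoQubit.principalRadius_jevticAnsatz hρ hD hw
  have hu := TwoQubit.unsteerable_iff hρ hD hw
  have hc := TwoQubit.two_pi_mul_jevticNorm_mul_det hw
  rw [hd] at hr hu hc
  have hgr : IsGreatest
      {r : ℝ | ∃ μ : MeasureTheory.Measure TwoQubit.BlochSphere,
        TwoQubit.IsAnsatz (TwoQubit.tState T) μ ∧
        r = TwoQubit.principalRadius (TwoQubit.tState T) μ}
      (2 * Real.pi * TwoQubit.jevticNorm T * |T.det|) := by
    refine ⟨⟨_, hJ, hr.symm⟩, ?_⟩
    rintro _ ⟨μ, hμ, rfl⟩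
    rw [hc]
    exact hμ.principalRadius_le hρ hD
  exact ⟨hJ, hr, hgr, hgr.csSup_eq, hu⟩
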